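/- Let $\mathcal{D}$ be a triangulated category with (set-indexed) coproducts, and write $\mathcal{X}^{\perp}$ for the class of objects $Y$ with $\mathrm{Hom}_{\mathcal{D}}(X,Y)=0$ for all $X\in\mathcal{X}$. Let $(\mathcal{U},\mathcal{U}^{\perp}[1])$ be a compactly generated t-structure on $\mathcal{D}$, that is, a t-structure for which there is a set $\mathcal{S}\subseteq\mathcal{U}$ of compact objects of $\mathcal{D}$ (objects $S$ such that $\mathrm{Hom}_{\mathcal{D}}(S,-)$, with values in abelian groups, preserves coproducts) such that $\mathcal{U}^{\perp}$ consists precisely of the objects $Y$ with $\mathrm{Hom}_{\mathcal{D}}(S[k],Y)=0$ for all $S\in\mathcal{S}$ and all integers $k\geq 0$. Then countable direct limits are exact in the heart $\mathcal{H}=\mathcal{U}\cap\mathcal{U}^{\perp}[1]$. That is, $\mathcal{H}$ is an abelian category, and for every countable (nonempty) directed set $I$, every direct system $I\to\mathcal{H}$ has a direct limit in $\mathcal{H}$ and the functor $\varinjlim_I:[I,\mathcal{H}]\to\mathcal{H}$ is exact. -/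

import Mathlib

open CategoryTheory CategoryTheory.Limits

universe w v u

namespace CompactlyGeneratedHeart

/-- An object `S` of an additive category with coproducts is compact if the functor
`Hom(S, -)`, with values in abelian groups, preserves (set-indexed) coproducts. -/
def IsCompactObject {D : Type u} [Category.{v} D] [Preadditive D] (S : D) : Prop :=
  ∀ J : Type v,
    PreservesColimitsOfShape (Discrete J) (preadditiveCoyoneda.obj (Opposite.op S))

section

variable {D : Type u} [Category.{v} D] [Preadditive D] [HasZeroObject D] [HasShift D ℤ]
  [∀ n : ℤ, (shiftFunctor D n).Additive] [Pretriangulated D]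

/-- The aisle `𝒰` of a t-structure. The t-structure itself is the pair `(𝒰, 𝒰^⊥[1])`, where
`𝒰 = t.le 0`, `𝒰^⊥ = t.ge 1` and `𝒰^⊥[1] = t.ge 0`. -/
def aisle (t : Triangulated.TStructure D) : ObjectProperty D := t.le 0

/-- The t-structure `t` is generated by a class `S` of objects of its aisle `𝒰`:
`𝒰^⊥` consists precisely of the objects `Y` such that `Hom(X[k], Y) = 0` for all `X` in `S`
and all integers `k ≥ 0`. -/
def IsGeneratedBy (t : Triangulated.TStructure D) (S : ObjectProperty D) : Prop :=
  S ≤ aisle t ∧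
    ∀ Y : D, (aisle t).rightOrthogonal Y ↔
      ∀ X : D, S X → ∀ k : ℤ, 0 ≤ k → ∀ f : X⟦k⟧ ⟶ Y, f = 0

/-- The t-structure `t` is compactly generated: it is generated by a (small) set of
compact objects of its aisle. -/
def IsCompactlyGenerated (t : Triangulated.TStructure D) : Prop :=
  ∃ S : ObjectProperty D, ObjectProperty.Small.{v} S ∧
    (∀ X : D, S X → IsCompactObject X) ∧ IsGeneratedBy t S

end

/-- The category `A` has a structure of abelian category whose additive structure is the
given one. -/
def IsAbelianCategory (A : Type u) [Category.{v} A] [P : Preadditive A] : Prop :=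
  ∃ a : Abelian A, a.toPreadditive = P

/-- `I`-colimits are exact in `A`: `A` has `I`-colimits and the functor
`colim : (I ⥤ A) ⥤ A` is exact (left exact and right exact). -/
def ColimitsAreExact (I : Type w) [Category.{w} I] (A : Type u) [Category.{v} A] : Prop :=
  ∃ _ : HasColimitsOfShape I A,
    PreservesFiniteLimits (colim : (I ⥤ A) ⥤ A) ∧
      PreservesFiniteColimits (colim : (I ⥤ A) ⥤ A)

end CompactlyGeneratedHeart

/-!
The colimit of a sequence is the cokernel of the map `1 - shift` on the coproduct of its terms. For
`W` countably compact, `Hom(W, -)` turns this map into the one of a sequence of abelian groups,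
which is injective; hence the cone of `1 - shift` on a coproduct of objects of the heart lies again
in the heart, where it is the cokernel, and `Hom(W, -)` preserves sequential colimits of the heart.
For `W` in the aisle, `Hom(W, -)` also preserves monomorphisms of the heart, and the functors
`Hom(W, -)` with `W` countably compact in the aisle jointly reflect them, so that exactness of
sequential colimits is inherited from abelian groups. A countable directed set receives a cofinal
sequence.
-/

namespace CompactlyGeneratedHeart

section CoproductProjections

variable {A : Type u} [Category.{v} A] [Preadditive A] {J : Type w} {X : J → A} {c : Cofan X}

/-- The morphism from a coproduct of the `X j` to `X i` that is the identity on the `i`-th summand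
and zero on the others; this is `Sigma.π` for an arbitrary colimit cofan. -/
noncomputable def coproductProj (hc : IsColimit c) (i : J) : c.pt ⟶ X i :=
  open Classical in Cofan.IsColimit.desc hc (Pi.single i (𝟙 (X i)))

@[simp]
lemma inj_coproductProj_self (hc : IsColimit c) (i : J) :
    c.inj i ≫ coproductProj hc i = 𝟙 (X i) := by
  simp [coproductProj]

lemma inj_coproductProj_of_ne (hc : IsColimit c) {i j : J} (h : j ≠ i) :
    c.inj j ≫ coproductProj hc i = 0 := by
  simp [coproductProj, h]

lemma eq_zero_of_coproductProj_eq_zero {X : J → AddCommGrpCat.{max w v}} {c : Cofan X}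
    (hc : IsColimit c) (x : c.pt) (hx : ∀ i, coproductProj hc i x = 0) : x = 0 := by
  classical
  let toDirectSum : c.pt ⟶ AddCommGrpCat.of (DirectSum J fun i ↦ X i) :=
    Cofan.IsColimit.desc hc fun i ↦ AddCommGrpCat.ofHom (DirectSum.of (fun i ↦ X i) i)
  let ofDirectSum : AddCommGrpCat.of (DirectSum J fun i ↦ X i) ⟶ c.pt :=
    AddCommGrpCat.ofHom (DirectSum.toAddMonoid fun i ↦ (c.inj i).hom)
  have retraction : toDirectSum ≫ ofDirectSum = 𝟙 c.pt :=
    Cofan.IsColimit.hom_ext hc _ _ fun i ↦ by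
      ext y
      simp [toDirectSum, ofDirectSum]
  have component (i : J) : toDirectSum ≫ AddCommGrpCat.ofHom (DFinsupp.evalAddMonoidHom i) =
      coproductProj hc i :=
    Cofan.IsColimit.hom_ext hc _ _ fun j ↦ by
      rw [reassoc_of% Cofan.IsColimit.fac hc _ j]
      ext y
      obtain rfl | h := eq_or_ne j i
      · exact (DirectSum.of_eq_same (β := fun i ↦ X i) j y).trans (by simp)
      · exact (DirectSum.of_eq_of_ne (β := fun i ↦ X i) j i y h.symm).trans
          (by simp [inj_coproductProj_of_ne hc h])
  have toDirectSum_eq_zero : toDirectSum x = 0 := DFinsupp.ext fun i ↦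
    (ConcreteCategory.congr_hom (component i) x).trans (hx i)
  calc x = (toDirectSum ≫ ofDirectSum) x := by rw [retraction, ConcreteCategory.id_apply]
    _ = 0 := by rw [ConcreteCategory.comp_apply, toDirectSum_eq_zero, map_zero]

end CoproductProjections

section MilnorMap

variable {A : Type u} [Category.{v} A] [Preadditive A] (F : ℕ ⥤ A) {c : Cofan F.obj}
  (hc : IsColimit c)

/-- The endomorphism `1 - shift` of a coproduct of the objects of a sequence, where `shift` is
induced by the transition maps. Its cokernel is the colimit of the sequence. -/
noncomputable def milnorMap : c.pt ⟶ c.pt :=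
  Cofan.IsColimit.desc hc fun n ↦ c.inj n - F.map (homOfLE n.le_succ) ≫ c.inj (n + 1)

@[simp]
lemma inj_milnorMap (n : ℕ) :
    c.inj n ≫ milnorMap F hc = c.inj n - F.map (homOfLE n.le_succ) ≫ c.inj (n + 1) := by
  simp [milnorMap]

lemma milnorMap_coproductProj_zero :
    milnorMap F hc ≫ coproductProj hc 0 = coproductProj hc 0 :=
  Cofan.IsColimit.hom_ext hc _ _ fun n ↦ by
    simp [reassoc_of% inj_milnorMap F hc n, inj_coproductProj_of_ne]

lemma milnorMap_coproductProj_succ (m : ℕ) :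
    milnorMap F hc ≫ coproductProj hc (m + 1) =
      coproductProj hc (m + 1) - coproductProj hc m ≫ F.map (homOfLE m.le_succ) :=
  Cofan.IsColimit.hom_ext hc _ _ fun n ↦ by
    obtain rfl | h := eq_or_ne n m
    · simp [reassoc_of% inj_milnorMap F hc n, reassoc_of% inj_coproductProj_self hc n]
    · simp [reassoc_of% inj_milnorMap F hc n, reassoc_of% inj_coproductProj_of_ne hc h,
        inj_coproductProj_of_ne hc (Nat.succ_ne_succ_iff.2 h)]

lemma comp_coproductProj_eq_zero_of_comp_milnorMap_eq_zero {Z : A} {z : Z ⟶ c.pt}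
    (hz : z ≫ milnorMap F hc = 0) (n : ℕ) : z ≫ coproductProj hc n = 0 := by
  induction n with
  | zero => rw [← milnorMap_coproductProj_zero F hc, reassoc_of% hz, zero_comp]
  | succ n ih =>
    have := z ≫= milnorMap_coproductProj_succ F hc n
    rwa [reassoc_of% hz, zero_comp, Preadditive.comp_sub, reassoc_of% ih, zero_comp, sub_zero,
      eq_comm] at this

instance mono_milnorMap (F : ℕ ⥤ AddCommGrpCat.{v}) {c : Cofan F.obj} (hc : IsColimit c) :
    Mono (milnorMap F hc) :=
  Preadditive.mono_of_cancel_zero _ fun z hz ↦ by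
    ext x
    exact eq_zero_of_coproductProj_eq_zero hc (z x) fun n ↦
      ConcreteCategory.congr_hom (comp_coproductProj_eq_zero_of_comp_milnorMap_eq_zero F hc hz n) x

/-- The cocone on `F` whose components are the restrictions to the summands of a morphism that
coequalizes `1 - shift` and zero. -/
noncomputable def milnorCocone (s : CokernelCofork (milnorMap F hc)) : Cocone F where
  pt := s.pt
  ι := NatTrans.ofSequence (fun n ↦ c.inj n ≫ s.π) fun n ↦ by
    have := c.inj n ≫= s.condition
    rw [reassoc_of% inj_milnorMap F hc n, Preadditive.sub_comp, comp_zero, sub_eq_zero] at this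
    simpa using this.symm

lemma milnorMap_comp_desc (t : Cocone F) :
    milnorMap F hc ≫ Cofan.IsColimit.desc hc t.ι.app = 0 :=
  Cofan.IsColimit.hom_ext hc _ _ fun n ↦ by
    simp [reassoc_of% inj_milnorMap F hc n]

noncomputable def isColimitMilnorCocone {s : CokernelCofork (milnorMap F hc)} (hs : IsColimit s) :
    IsColimit (milnorCocone F hc s) where
  desc t := hs.desc (CokernelCofork.ofπ _ (milnorMap_comp_desc F hc t))
  fac t n := by
    change (c.inj n ≫ s.π) ≫ _ = _
    rw [Category.assoc, Cofork.IsColimit.π_desc hs]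
    exact Cofan.IsColimit.fac hc _ n
  uniq t m hm := Cofork.IsColimit.hom_ext hs <| Cofan.IsColimit.hom_ext hc _ _ fun n ↦ by
    rw [Cofork.IsColimit.π_desc hs]
    exact (Category.assoc _ _ _).symm.trans ((hm n).trans (Cofan.IsColimit.fac hc _ n).symm)

section Functoriality

variable {B : Type*} [Category* B] [Preadditive B] (G : A ⥤ B)
  [PreservesColimit (Discrete.functor F.obj) G]

noncomputable def isColimitMapCofan :
    IsColimit (Cofan.mk (G.obj c.pt) (fun n ↦ G.map (c.inj n)) : Cofan (F ⋙ G).obj) :=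
  isColimitCofanMkObjOfIsColimit G F.obj c.inj
    (IsColimit.ofIsoColimit hc (Cofan.ext (Iso.refl c.pt)))

variable [G.Additive]

lemma map_milnorMap :
    G.map (milnorMap F hc) = milnorMap (F ⋙ G) (isColimitMapCofan F hc G) :=
  Cofan.IsColimit.hom_ext (isColimitMapCofan F hc G) _ _ fun n ↦ by
    rw [inj_milnorMap]
    change G.map (c.inj n) ≫ G.map (milnorMap F hc) =
      G.map (c.inj n) - G.map (F.map _) ≫ G.map (c.inj (n + 1))
    rw [← G.map_comp, inj_milnorMap, G.map_sub, G.map_comp]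

lemma preservesColimit_of_isColimit_map_milnorMap {s : CokernelCofork (milnorMap F hc)}
    (hs : IsColimit s) (hGs : IsColimit (s.map G)) : PreservesColimit F G :=
  preservesColimit_of_preserves_colimit_cocone (isColimitMilnorCocone F hc hs) <|
    IsColimit.ofIsoColimit
      (isColimitMilnorCocone (F ⋙ G) (isColimitMapCofan F hc G)
        (CokernelCofork.isColimitOfIsColimitOfIff' hGs _ fun _ _ ↦ by rw [map_milnorMap]))
      (Cocone.ext (Iso.refl _) fun n ↦ by
        dsimp [milnorCocone]
        exact (Category.comp_id _).trans (G.map_comp _ _).symm)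

end Functoriality

instance mono_map_milnorMap (G : A ⥤ AddCommGrpCat.{v}) [G.Additive]
    [PreservesColimit (Discrete.functor F.obj) G] : Mono (G.map (milnorMap F hc)) := by
  rw [map_milnorMap]
  infer_instance

end MilnorMap

section SequentialColimits

variable {A : Type u} [Category.{v} A]

lemma hasColimitsOfShape_nat [Preadditive A] [HasCokernels A]
    [HasColimitsOfShape (Discrete ℕ) A] : HasColimitsOfShape ℕ A where
  has_colimit F := ⟨_, isColimitMilnorCocone F (coproductIsCoproduct F.obj) (cokernelIsCokernel _)⟩

lemma preservesMonomorphisms_colim {J : Type*} [Category* J] [HasPullbacks A]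
    [HasColimitsOfShape J A] {ι : Type*} {B : ι → Type*} [∀ i, Category* (B i)]
    [∀ i, HasColimitsOfShape J (B i)]
    [∀ i, (colim : (J ⥤ B i) ⥤ B i).PreservesMonomorphisms] {G : ∀ i, A ⥤ B i}
    [∀ i, (G i).PreservesMonomorphisms] [∀ i, PreservesColimitsOfShape J (G i)]
    (hG : JointlyReflectMonomorphisms G) :
    (colim : (J ⥤ A) ⥤ A).PreservesMonomorphisms where
  preserves {X Y} φ _ := by
    have (i : ι) : Mono ((G i).map (colimMap φ)) := by
      have (j : J) : Mono ((Functor.whiskerRight φ (G i)).app j) :=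
        inferInstanceAs (Mono ((G i).map (φ.app j)))
      have := NatTrans.mono_of_mono_app (Functor.whiskerRight φ (G i))
      exact colim.map_mono' (Functor.whiskerRight φ (G i))
        (isColimitOfPreserves (G i) (colimit.isColimit X))
        (isColimitOfPreserves (G i) (colimit.isColimit Y)) _
        fun j ↦ by simp [← Functor.map_comp]
    exact hG.mono (colimMap φ)

lemma colimitsAreExact_of_preservesMonomorphisms_colim_nat [Abelian A] [HasColimitsOfShape ℕ A]
    [(colim : (ℕ ⥤ A) ⥤ A).PreservesMonomorphisms] (I : Type w) [Preorder I] [IsDirectedOrder I]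
    [Nonempty I] [Countable I] : ColimitsAreExact I A := by
  have := hasExactColimitsOfShape_of_preservesMono (C := A) ℕ
  have : HasColimitsOfShape I A :=
    Functor.Final.hasColimitsOfShape_of_final (IsFiltered.sequentialFunctor I)
  have := hasExactColimitsOfShape_of_final A (IsFiltered.sequentialFunctor I)
  exact ⟨inferInstance, inferInstance, inferInstance⟩

end SequentialColimits

section Coyoneda

variable {A : Type u} [Category.{v} A] [Preadditive A]

lemma mono_preadditiveCoyoneda_map_iff {W X Y : A} (f : X ⟶ Y) :
    Mono ((preadditiveCoyoneda.obj (Opposite.op W)).map f) ↔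
      ∀ x : W ⟶ X, x ≫ f = 0 → x = 0 := by
  rw [AddCommGrpCat.mono_iff_injective, injective_iff_map_eq_zero]
  rfl

lemma epi_preadditiveCoyoneda_map_iff {W X Y : A} (f : X ⟶ Y) :
    Epi ((preadditiveCoyoneda.obj (Opposite.op W)).map f) ↔
      ∀ y : W ⟶ Y, ∃ x : W ⟶ X, x ≫ f = y := by
  rw [AddCommGrpCat.epi_iff_surjective]
  rfl

end Coyoneda

section CountablyCompact

variable {A : Type u} [Category.{v} A] [Preadditive A]

variable (A) in
/-- The countably compact objects: those `X` such that `Hom(X, -)` preserves countable coproducts.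
Only these coproducts enter the construction of sequential colimits. -/
def countablyCompact : ObjectProperty A := fun X ↦
  PreservesColimitsOfShape (Discrete ℕ) (preadditiveCoyoneda.obj (Opposite.op X))

lemma IsCompactObject.countablyCompact {X : A} (hX : IsCompactObject X) :
    countablyCompact A X :=
  have := hX (ULift.{v} ℕ)
  preservesColimitsOfShape_of_equiv (Discrete.equivalence Equiv.ulift) _

lemma countablyCompact_obj_of_adjunction {B : Type*} [Category.{v} B] [Preadditive B] {L : A ⥤ B}
    {R : B ⥤ A} [L.Additive] (adj : L ⊣ R) [PreservesColimitsOfShape (Discrete ℕ) R] {X : A}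
    (hX : countablyCompact A X) : countablyCompact B (L.obj X) :=
  let homIso : preadditiveCoyoneda.obj (Opposite.op (L.obj X)) ≅
      R ⋙ preadditiveCoyoneda.obj (Opposite.op X) :=
    NatIso.ofComponents (fun Y ↦ (adj.homAddEquiv X Y).toAddCommGrpIso) fun f ↦ by
      ext g
      exact adj.homEquiv_naturality_right g f
  have : PreservesColimitsOfShape (Discrete ℕ) (preadditiveCoyoneda.obj (Opposite.op X)) := hX
  preservesColimitsOfShape_of_natIso homIso.symm

lemma countablyCompact_shift [HasShift A ℤ] [∀ n : ℤ, (shiftFunctor A n).Additive] {X : A}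
    (hX : countablyCompact A X) (n : ℤ) : countablyCompact A (X⟦n⟧) :=
  countablyCompact_obj_of_adjunction (L := shiftFunctor A n) (shiftEquiv A n).toAdjunction hX

lemma isClosedUnderColimitsOfShape_rightOrthogonal {P : ObjectProperty A} {J : Type*} [Category* J]
    (hP : ∀ X, P X → PreservesColimitsOfShape J (preadditiveCoyoneda.obj (Opposite.op X))) :
    P.rightOrthogonal.IsClosedUnderColimitsOfShape J where
  colimitsOfShape_le := by
    rintro Y ⟨p⟩ X f hX
    have := hP X hX
    have hom_isZero : IsZero (p.diag ⋙ preadditiveCoyoneda.obj (Opposite.op X)) :=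
      Functor.isZero _ fun j ↦ AddCommGrpCat.isZero_of_iff_subsingleton.2 <|
        subsingleton_of_forall_eq (0 : X ⟶ p.diag.obj j) fun g ↦ p.prop_diag_obj j g hX
    exact (AddCommGrpCat.subsingleton_of_isZero (IsColimit.isZero_pt (isColimitOfPreserves
      (preadditiveCoyoneda.obj (Opposite.op X)) p.isColimit) hom_isZero)).elim _ _

lemma isClosedUnderColimitsOfShape_leftOrthogonal (P : ObjectProperty A) (J : Type*)
    [Category* J] : P.leftOrthogonal.IsClosedUnderColimitsOfShape J where
  colimitsOfShape_le := by
    rintro X ⟨p⟩ Y f hY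
    exact p.isColimit.hom_ext fun j ↦ (p.prop_diag_obj j _ hY).trans comp_zero.symm

end CountablyCompact

open Pretriangulated Triangulated ZeroObject

variable {D : Type u} [Category.{v} D] [Preadditive D] [HasZeroObject D] [HasShift D ℤ]
  [∀ n : ℤ, (shiftFunctor D n).Additive] [Pretriangulated D]

section Heart

variable (t : TStructure D)

instance isLE_heart_obj (X : t.heart.FullSubcategory) : t.IsLE X.obj 0 := ⟨X.property.1⟩

instance isGE_heart_obj (X : t.heart.FullSubcategory) : t.IsGE X.obj 0 := ⟨X.property.2⟩

instance containsZero_heart : t.heart.ContainsZero where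
  exists_zero := ⟨0, isZero_zero D, (t.mem_heart_iff _).2 ⟨inferInstance, inferInstance⟩⟩

instance isTriangulatedClosed₂_heart : t.heart.IsTriangulatedClosed₂ :=
  .mk' fun T hT h₁ h₃ ↦ by
    rw [t.mem_heart_iff] at h₁ h₃ ⊢
    exact ⟨t.isLE₂ T hT 0 h₁.1 h₃.1, t.isGE₂ T hT 0 h₁.2 h₃.2⟩

instance isClosedUnderBinaryProducts_heart : t.heart.IsClosedUnderBinaryProducts :=
  .mk' (by
    rintro _ ⟨F, hF⟩
    exact t.heart.prop_of_iso (HasLimit.isoOfNatIso (diagramIsoPair F)).symm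
      (t.heart.ext_of_isTriangulatedClosed₂ _ (binaryProductTriangle_distinguished _ _)
        (hF _) (hF _)))

instance isClosedUnderFiniteProducts_heart : t.heart.IsClosedUnderFiniteProducts := .mk'

lemma heart_hom_shift_eq_zero ⦃X Y : t.heart.FullSubcategory⦄ ⦃n : ℤ⦄
    (f : t.heart.ι.obj X ⟶ (t.heart.ι.obj Y)⟦n⟧) (hn : n < 0) : f = 0 := by
  have : t.IsGE ((t.heart.ι.obj Y)⟦n⟧) (-n) := t.isGE_shift Y.obj 0 n (-n)
  exact t.zero_of_isLE_of_isGE f 0 (-n) (by lia) (isLE_heart_obj t X) this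

section Cone

variable {T : Triangle D} (hT : T ∈ distTriang D)

include hT

lemma isLE_obj₃_of_distTriang {n : ℤ} (h₁ : t.IsLE T.obj₁ n) (h₂ : t.IsLE T.obj₂ n) :
    t.IsLE T.obj₃ n := by
  have := t.isLE_shift T.obj₁ n 1 (n - 1)
  exact t.isLE₂ _ (rot_of_distTriang _ hT) n h₂ (t.isLE_of_le (T.obj₁⟦(1 : ℤ)⟧) (n - 1) n)

lemma isGE_obj₃_of_distTriang {n : ℤ} (h₁ : t.IsGE T.obj₁ (n + 1)) (h₂ : t.IsGE T.obj₂ n) :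
    t.IsGE T.obj₃ n :=
  t.isGE₂ _ (rot_of_distTriang _ hT) n h₂ (t.isGE_shift T.obj₁ (n + 1) 1 n)

end Cone

variable [IsTriangulated D]

lemma heart_truncGE_zero (X : D) [t.IsLE X 0] : t.heart ((t.truncGE 0).obj X) :=
  (t.mem_heart_iff _).2 ⟨inferInstance, inferInstance⟩

lemma heart_shift_truncLT_zero (X : D) [t.IsGE X (-1)] :
    t.heart (((t.truncLT 0).obj X)⟦(-1 : ℤ)⟧) :=
  have : t.IsLE ((t.truncLT 0).obj X) (-1) := t.isLE_truncLT_obj X 0 (-1)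
  (t.mem_heart_iff _).2 ⟨t.isLE_shift _ (-1) (-1) 0, t.isGE_shift _ (-1) (-1) 0⟩

lemma exists_distTriang_shift_heart (X : D) [t.IsLE X 0] [t.IsGE X (-1)] :
    ∃ (K Q : t.heart.FullSubcategory) (α : K.obj⟦(1 : ℤ)⟧ ⟶ X) (β : X ⟶ Q.obj)
      (γ : Q.obj ⟶ K.obj⟦(1 : ℤ)⟧⟦(1 : ℤ)⟧), Triangle.mk α β γ ∈ distTriang D := by
  let e : ((t.truncLT 0).obj X)⟦(-1 : ℤ)⟧⟦(1 : ℤ)⟧ ≅ (t.truncLT 0).obj X :=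
    (shiftEquiv D (1 : ℤ)).counitIso.app _
  refine ⟨⟨_, heart_shift_truncLT_zero t X⟩, ⟨_, heart_truncGE_zero t X⟩,
    e.hom ≫ (t.truncLTι 0).app X, (t.truncGEπ 0).app X, (t.truncGEδLT 0).app X ≫ e.inv⟦1⟧',
    isomorphic_distinguished _ (t.triangleLTGE_distinguished 0 X) _ <|
      Triangle.isoMk _ _ e (Iso.refl _) (Iso.refl _) ?_ ?_ ?_⟩
  · exact Category.comp_id _
  · exact (Category.comp_id _).trans (Category.id_comp _).symm
  · change ((t.truncGEδLT 0).app X ≫ e.inv⟦1⟧') ≫ e.hom⟦1⟧' = 𝟙 _ ≫ (t.truncGEδLT 0).app X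
    rw [Category.assoc, ← Functor.map_comp, e.inv_hom_id, CategoryTheory.Functor.map_id,
      Category.id_comp]
    exact Category.comp_id _

lemma admissibleMorphism_heart : AbelianSubcategory.admissibleMorphism t.heart.ι = ⊤ := by
  ext X₁ X₂ f₁
  refine ⟨fun _ ↦ trivial, fun _ X₃ f₂ f₃ hT ↦ ?_⟩
  have : t.IsLE X₃ 0 := isLE_obj₃_of_distTriang t hT (isLE_heart_obj t X₁) (isLE_heart_obj t X₂)
  have : t.IsGE X₃ (-1) := isGE_obj₃_of_distTriang t hT (isGE_heart_obj t X₁)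
    (t.isGE_of_ge X₂.obj (-1) 0)
  exact exists_distTriang_shift_heart t X₃

/-- The heart of a t-structure is abelian: the kernel and the cokernel of a morphism are read off
from the truncation triangle of its cone. -/
noncomputable abbrev abelianHeart : Abelian t.heart.FullSubcategory :=
  AbelianSubcategory.abelian t.heart.ι (heart_hom_shift_eq_zero t) (admissibleMorphism_heart t)

lemma isAbelianCategory_heart : IsAbelianCategory t.heart.FullSubcategory :=
  ⟨abelianHeart t, rfl⟩

lemma eq_zero_of_comp_mono_heart {X Y : t.heart.FullSubcategory} (f : X ⟶ Y) [Mono f] {W : D}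
    [t.IsLE W 0] {x : W ⟶ X.obj} (hx : x ≫ f.hom = 0) : x = 0 := by
  let truncated_x : (⟨_, heart_truncGE_zero t W⟩ : t.heart.FullSubcategory) ⟶ X :=
    ObjectProperty.homMk (t.descTruncGE x 0)
  have truncated_x_comp : truncated_x ≫ f = 0 := t.heart.ι.map_injective <|
    t.from_truncGE_obj_ext (Y := Y.obj) <|
      (t.π_descTruncGE_assoc x 0 f.hom).trans (hx.trans comp_zero.symm)
  have desc_eq_zero : t.descTruncGE x 0 = 0 :=
    t.heart.ι.congr_map (zero_of_comp_mono f truncated_x_comp)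
  rw [← t.π_descTruncGE x 0, desc_eq_zero, comp_zero]

instance preservesMonomorphisms_heartHom (W : D) [t.IsLE W 0] :
    (t.heart.ι ⋙ preadditiveCoyoneda.obj (Opposite.op W)).PreservesMonomorphisms where
  preserves f _ := (mono_preadditiveCoyoneda_map_iff (t.heart.ι.map f)).2 fun _ hx ↦
    eq_zero_of_comp_mono_heart t f hx

end Heart

section Generation

/-- A weakening of compact generation: the objects of `𝒰^⊥` are detected by morphisms from the
countably compact objects of the aisle `𝒰`. -/
def IsCountablyCompactlyGenerated (t : TStructure D) : Prop :=
  (aisle t ⊓ countablyCompact D).rightOrthogonal ≤ t.ge 1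

lemma aisle_shift {t : TStructure D} {X : D} (hX : aisle t X) {k : ℤ} (hk : 0 ≤ k) :
    aisle t (X⟦k⟧) :=
  t.le_monotone (neg_nonpos.2 hk) _ (t.le_shift 0 k (-k) (add_neg_cancel k) X hX)

lemma IsCompactlyGenerated.isCountablyCompactlyGenerated {t : TStructure D}
    (ht : IsCompactlyGenerated t) : IsCountablyCompactlyGenerated t := by
  obtain ⟨S, -, compact_S, S_le_aisle, generates⟩ := ht
  intro Y hY
  have : (aisle t).rightOrthogonal Y := (generates Y).2 fun X hX k hk f ↦
    hY f ⟨aisle_shift (S_le_aisle X hX) hk,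
      countablyCompact_shift (compact_S X hX).countablyCompact k⟩
  exact ((t.isGE_iff_orthogonal 0 1 rfl Y).2 fun X f hX ↦ this f hX.le).ge

lemma le_zero_eq_leftOrthogonal (t : TStructure D) : t.le 0 = (t.ge 1).leftOrthogonal :=
  le_antisymm (fun _ hX _ f hY ↦ t.zero' f hX hY) fun X hX ↦
    ((t.isLE_iff_orthogonal 0 1 rfl X).2 fun _ f hY ↦ hX f hY.ge).le

lemma epi_coyoneda_map_mor₂ {T : Triangle D} (hT : T ∈ distTriang D) (W : D)
    [Mono ((preadditiveCoyoneda.obj (Opposite.op W)).map (T.mor₁⟦(1 : ℤ)⟧'))] :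
    Epi ((preadditiveCoyoneda.obj (Opposite.op W)).map T.mor₂) := by
  rw [epi_preadditiveCoyoneda_map_iff]
  intro x
  have mor₃_eq_zero : x ≫ T.mor₃ = 0 := (mono_preadditiveCoyoneda_map_iff _).1 ‹_› _ <| by
    rw [Category.assoc, comp_distTriang_mor_zero₃₁ T hT, comp_zero]
  obtain ⟨y, hy⟩ := Triangle.coyoneda_exact₃ T hT x mor₃_eq_zero
  exact ⟨y, hy.symm⟩

variable {t : TStructure D} (ht : IsCountablyCompactlyGenerated t)

section

include ht

lemma ge_one_eq_rightOrthogonal :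
    t.ge 1 = (aisle t ⊓ countablyCompact D).rightOrthogonal :=
  le_antisymm (fun _ hY _ f hX ↦ t.zero' f hX.1 hY) ht

lemma isGE_zero_of_hom_shift_eq_zero {Y : D}
    (hY : ∀ W : D, aisle t W → countablyCompact D W → ∀ f : W⟦(1 : ℤ)⟧ ⟶ Y, f = 0) :
    t.IsGE Y 0 := by
  suffices t.IsGE (Y⟦(-1 : ℤ)⟧) 1 from t.isGE_of_shift Y 0 (-1) 1
  refine ⟨ht _ fun W f hW ↦ ?_⟩
  have adj : shiftFunctor D (1 : ℤ) ⊣ shiftFunctor D (-1 : ℤ) := (shiftEquiv D (1 : ℤ)).toAdjunction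
  rw [← (adj.homAddEquiv W Y).symm.map_eq_zero_iff]
  exact hY W hW.1 hW.2 _

lemma isClosedUnderColimitsOfShape_discrete_nat_heart :
    t.heart.IsClosedUnderColimitsOfShape (Discrete ℕ) := by
  have ge_one_closed : (t.ge 1).IsClosedUnderColimitsOfShape (Discrete ℕ) := by
    rw [ge_one_eq_rightOrthogonal ht]
    exact isClosedUnderColimitsOfShape_rightOrthogonal fun _ hX ↦ hX.2
  have ge_zero_closed : (t.ge 0).IsClosedUnderColimitsOfShape (Discrete ℕ) := by
    rw [← t.shift_ge (-1) 1 0 rfl]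
    exact .inverseImage _ (t.ge 1) (shiftFunctor D (-1 : ℤ))
  have le_zero_closed : (t.le 0).IsClosedUnderColimitsOfShape (Discrete ℕ) := by
    rw [le_zero_eq_leftOrthogonal t]
    exact isClosedUnderColimitsOfShape_leftOrthogonal _ _
  exact ⟨fun _ ⟨p⟩ ↦ ⟨(t.le 0).prop_of_isColimit p.isColimit fun j ↦ (p.prop_diag_obj j).1,
    (t.ge 0).prop_of_isColimit p.isColimit fun j ↦ (p.prop_diag_obj j).2⟩⟩

lemma isGE_zero_obj₃_of_mono_map_shift_mor₁ {T : Triangle D} (hT : T ∈ distTriang D)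
    (h₂ : t.IsGE T.obj₂ 0)
    (hmono : ∀ W : D, countablyCompact D W →
      Mono ((preadditiveCoyoneda.obj (Opposite.op W)).map (T.mor₁⟦(1 : ℤ)⟧'))) :
    t.IsGE T.obj₃ 0 :=
  isGE_zero_of_hom_shift_eq_zero ht fun W hW hW' f ↦ by
    have shift_isLE : t.IsLE (W⟦(1 : ℤ)⟧) (-1) := ⟨t.le_shift 0 1 (-1) rfl W hW⟩
    have := hmono _ (countablyCompact_shift hW' 1)
    have := epi_coyoneda_map_mor₂ hT (W⟦(1 : ℤ)⟧)
    obtain ⟨g, rfl⟩ := (epi_preadditiveCoyoneda_map_iff _).1 this f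
    rw [t.zero_of_isLE_of_isGE g (-1) 0 (by lia) shift_isLE h₂, zero_comp]

lemma isZero_of_forall_countablyCompact_hom_eq_zero (X : t.heart.FullSubcategory)
    (hX : ∀ W : D, aisle t W → countablyCompact D W → ∀ f : W ⟶ X.obj, f = 0) : IsZero X := by
  have : t.IsGE X.obj 1 := ⟨ht _ fun W f hW ↦ hX W hW.1 hW.2 f⟩
  exact .of_full_of_faithful_of_isZero t.heart.ι X (t.isZero X.obj 0 1)

lemma jointlyReflectMonomorphisms_heartHom [IsTriangulated D] :
    JointlyReflectMonomorphisms fun W : (aisle t ⊓ countablyCompact D).FullSubcategory ↦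
      t.heart.ι ⋙ preadditiveCoyoneda.obj (Opposite.op W.obj) where
  mono {X Y} f mono_hom_f := by
    let _ := abelianHeart t
    refine Preadditive.mono_of_isZero_kernel f <|
      isZero_of_forall_countablyCompact_hom_eq_zero ht _ fun W hW hW' x ↦ ?_
    have : t.IsLE W 0 := ⟨hW⟩
    have kernel_condition : (kernel.ι f).hom ≫ f.hom = 0 :=
      t.heart.ι.congr_map (kernel.condition f)
    exact eq_zero_of_comp_mono_heart t (kernel.ι f) <|
      (mono_preadditiveCoyoneda_map_iff f.hom).1 (mono_hom_f ⟨W, hW, hW'⟩) _ <| by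
        rw [Category.assoc, kernel_condition, comp_zero]

end

section Milnor

variable [HasColimitsOfShape (Discrete ℕ) D] [t.heart.IsClosedUnderColimitsOfShape (Discrete ℕ)]
  (F : ℕ ⥤ t.heart.FullSubcategory) {c : Cofan F.obj} (hc : IsColimit c)

lemma mono_coyoneda_map_shift_milnorMap {W : D} (hW : countablyCompact D W) :
    Mono ((preadditiveCoyoneda.obj (Opposite.op W)).map
      ((t.heart.ι.map (milnorMap F hc))⟦(1 : ℤ)⟧')) :=
  have : PreservesColimitsOfShape (Discrete ℕ) (preadditiveCoyoneda.obj (Opposite.op W)) := hW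
  mono_map_milnorMap F hc
    (t.heart.ι ⋙ shiftFunctor D (1 : ℤ) ⋙ preadditiveCoyoneda.obj (Opposite.op W))

include ht in
lemma exists_distTriang_milnorMap :
    ∃ (Q : t.heart.FullSubcategory) (q : c.pt ⟶ Q) (δ : Q.obj ⟶ c.pt.obj⟦(1 : ℤ)⟧),
      Triangle.mk (t.heart.ι.map (milnorMap F hc)) (t.heart.ι.map q) δ ∈ distTriang D := by
  obtain ⟨M, q, δ, hT⟩ := distinguished_cocone_triangle (t.heart.ι.map (milnorMap F hc))
  have hLE : t.IsLE M 0 :=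
    isLE_obj₃_of_distTriang t hT (isLE_heart_obj t c.pt) (isLE_heart_obj t c.pt)
  have hGE : t.IsGE M 0 := isGE_zero_obj₃_of_mono_map_shift_mor₁ ht hT (isGE_heart_obj t c.pt)
    fun W hW ↦ mono_coyoneda_map_shift_milnorMap F hc hW
  exact ⟨⟨M, hLE.le, hGE.ge⟩, ObjectProperty.homMk q, δ, hT⟩

include ht in
lemma preservesColimitsOfShape_nat_heartHom {W : D} (hW : countablyCompact D W) :
    PreservesColimitsOfShape ℕ (t.heart.ι ⋙ preadditiveCoyoneda.obj (Opposite.op W)) where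
  preservesColimit {F} := by
    have : PreservesColimitsOfShape (Discrete ℕ) (preadditiveCoyoneda.obj (Opposite.op W)) := hW
    let hc := coproductIsCoproduct F.obj
    obtain ⟨Q, q, δ, hT⟩ := exists_distTriang_milnorMap ht F hc
    have : Mono ((preadditiveCoyoneda.obj (Opposite.op W)).map
        ((Triangle.mk (t.heart.ι.map (milnorMap F hc)) (t.heart.ι.map q) δ).mor₁⟦(1 : ℤ)⟧')) :=
      mono_coyoneda_map_shift_milnorMap F hc hW
    have homs_exact := (preadditiveCoyoneda.obj (Opposite.op W)).map_distinguished_exact _ hT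
    have : Epi (((shortComplexOfDistTriangle _ hT).map
      (preadditiveCoyoneda.obj (Opposite.op W))).g) := epi_coyoneda_map_mor₂ hT W
    exact preservesColimit_of_isColimit_map_milnorMap F hc _
      (AbelianSubcategory.isColimitCokernelCoforkOfDistTriang (heart_hom_shift_eq_zero t) _ q δ hT)
      homs_exact.gIsCokernel

end Milnor

lemma hasColimitsOfShape_nat_heart [IsTriangulated D] [HasColimitsOfShape (Discrete ℕ) D]
    [t.heart.IsClosedUnderColimitsOfShape (Discrete ℕ)] :
    HasColimitsOfShape ℕ t.heart.FullSubcategory :=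
  let _ := abelianHeart t
  hasColimitsOfShape_nat

include ht in
lemma preservesMonomorphisms_colim_nat_heart [IsTriangulated D] [HasColimitsOfShape (Discrete ℕ) D]
    [t.heart.IsClosedUnderColimitsOfShape (Discrete ℕ)]
    [HasColimitsOfShape ℕ t.heart.FullSubcategory] :
    (colim : (ℕ ⥤ t.heart.FullSubcategory) ⥤ _).PreservesMonomorphisms := by
  let _ := abelianHeart t
  have (W : (aisle t ⊓ countablyCompact D).FullSubcategory) : t.IsLE W.obj 0 := ⟨W.property.1⟩
  have (W : (aisle t ⊓ countablyCompact D).FullSubcategory) :=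
    preservesColimitsOfShape_nat_heartHom ht W.property.2
  have : HasExactColimitsOfShape ℕ AddCommGrpCat.{v} :=
    .of_domain_equivalence AddCommGrpCat.{v} (ULiftHomULiftCategory.equiv.{v, v} ℕ).symm
  exact preservesMonomorphisms_colim (jointlyReflectMonomorphisms_heartHom ht)

end Generation

end CompactlyGeneratedHeart

theorem mainTheorem2_general {D : Type u} [Category.{v} D] [Preadditive D] [HasZeroObject D]
    [HasShift D ℤ] [∀ n : ℤ, (shiftFunctor D n).Additive] [Pretriangulated D]
    [IsTriangulated D] [HasColimitsOfShape (Discrete ℕ) D]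
    (t : Triangulated.TStructure D)
    (ht : CompactlyGeneratedHeart.IsCountablyCompactlyGenerated t) :
    CompactlyGeneratedHeart.IsAbelianCategory t.heart.FullSubcategory ∧
      ∀ (I : Type w) [Preorder I] [IsDirectedOrder I] [Nonempty I] [Countable I],
        CompactlyGeneratedHeart.ColimitsAreExact I t.heart.FullSubcategory := by
  refine ⟨CompactlyGeneratedHeart.isAbelianCategory_heart t, fun I _ _ _ _ ↦ ?_⟩
  let _ := CompactlyGeneratedHeart.abelianHeart t
  have := CompactlyGeneratedHeart.isClosedUnderColimitsOfShape_discrete_nat_heart ht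
  have := CompactlyGeneratedHeart.hasColimitsOfShape_nat_heart (t := t)
  have := CompactlyGeneratedHeart.preservesMonomorphisms_colim_nat_heart ht
  exact CompactlyGeneratedHeart.colimitsAreExact_of_preservesMonomorphisms_colim_nat I

theorem mainTheorem2 {D : Type u} [Category.{v} D] [Preadditive D] [HasZeroObject D]
    [HasShift D ℤ] [∀ n : ℤ, (shiftFunctor D n).Additive] [Pretriangulated D]
    [IsTriangulated D] [HasCoproducts.{v} D]
    (t : Triangulated.TStructure D)
    (ht : CompactlyGeneratedHeart.IsCompactlyGenerated t) :
    CompactlyGeneratedHeart.IsAbelianCategory t.heart.FullSubcategory ∧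
      ∀ (I : Type w) [Preorder I] [IsDirectedOrder I] [Nonempty I] [Countable I],
        CompactlyGeneratedHeart.ColimitsAreExact I t.heart.FullSubcategory :=
  have : HasColimitsOfShape (Discrete ℕ) D :=
    hasColimitsOfShape_of_equivalence (Discrete.equivalence (Equiv.ulift.{v} (α := ℕ)))
  mainTheorem2_general t ht.isCountablyCompactlyGenerated
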